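/- Let $\mathbb N_0=\{0,1,2,\dots\}$ and $\mathbb N=\{1,2,\dots\}$. **Teaching dimensions.** Let $\mathcal L$ be a family of subsets (concepts) of a set $\mathcal X$. A set $T\subseteq\mathcal X\times\{-,+\}$ of labeled examples is *consistent* with $L\subseteq\mathcal X$ if $x\in L$ for all $(x,+)\in T$ and $x\notin L$ for all $(x,-)\in T$; it is *positive* if it contains no $(x,-)$. Let $\prec$ be a strict partial order on $\mathcal L$. A *teaching set* for $L\in\mathcal L$ w.r.t. $(\mathcal L,\prec)$ is a set $T$ of labeled examples such that $L$ is the only concept in $\mathcal L\setminus\{L'\in\mathcal L: L'\prec L\}$ consistent with $T$. Put $$\mathrm{PBTD}(\mathcal L)=\inf_{\prec}\ \sup_{L\in\mathcal L}\ \inf\{|T| : T \text{ is a teaching set for } L \text{ w.r.t. } (\mathcal L,\prec)\}\in\mathbb N_0\cup\{\infty\},$$ where $\prec$ ranges over all strict partial orders on $\mathcal L$, and define $\mathrm{PBTD}^+(\mathcal L)$ in the same way with $T$ restricted to positive teaching sets. **Linear sets.** For a finite nonempty $G\subset\mathbb N$ let $\langle G\rangle=\{\sum_{g\in G}a_g g: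 a_g\in\mathbb N_0\}$ and $\langle G\rangle_+=\{\sum_{g\in G}a_g g: a_g\in\mathbb N\}$. For $k\ge 1$ define the following classes of subsets of $\mathbb N_0$, where $G$ ranges over the sets $G\subset\mathbb N$ with $1\le|G|\le k$: $$\mathrm{LINSET}_k=\{\langle G\rangle\},\qquad \mathrm{CFLINSET}_k=\{\langle G\rangle:\gcd(G)=1\},$$ $$\mathrm{NELINSET}_k=\{\langle G\rangle_+\},\qquad \mathrm{NECFLINSET}_k=\{\langle G\rangle_+:\gcd(G)=1\}.$$ The *shift-extension* of a class $\mathcal L$ of subsets of $\mathbb N_0$ is $\mathcal L'=\{c+L: c\in\mathbb N_0,\ L\in\mathcal L\}$. **Theorem.** Let $k\ge 1$. 1. $\mathrm{PBTD}^+(\mathrm{LINSET}_k)=k$ and $\mathrm{PBTD}(\mathrm{LINSET}_k)\in\{k-1,k\}$. 2. $\mathrm{PBTD}^+(\mathrm{CFLINSET}_k)=k$ if $k\ge 2$, and $\mathrm{PBTD}(\mathrm{CFLINSET}_k)\in\{k-1,k\}$. 3. For $\mathcal L\in\{\mathrm{NELINSET}_k,\mathrm{NECFLINSET}_k\}$: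 $k-1\le\mathrm{PBTD}^+(\mathcal L)\le k$ and $\lfloor\frac{k-1}{2}\rfloor\le\mathrm{PBTD}(\mathcal L)\le k$. 4. $\mathrm{PBTD}^+(\mathcal L')=k+1$ for $\mathcal L\in\{\mathrm{LINSET}_k,\mathrm{NELINSET}_k\}$, and, if $k\ge 2$, also for $\mathcal L\in\{\mathrm{CFLINSET}_k,\mathrm{NECFLINSET}_k\}$. 5. $\mathrm{PBTD}(\mathcal L')\in\{k-1,k,k+1\}$ for all $\mathcal L\in\{\mathrm{LINSET}_k,\mathrm{CFLINSET}_k,\mathrm{NELINSET}_k,\mathrm{NECFLINSET}_k\}$. -/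

import Mathlib

namespace Teaching

section General

variable {X : Type*}

/-- A set of labeled examples over `X`; the label `true` is `+`, the label `false` is `-`. -/
abbrev LabeledSet (X : Type*) := Set (X × Bool)

/-- `L` contains all positively labeled and none of the negatively labeled examples of `T`. -/
def Consistent (L : Set X) (T : LabeledSet X) : Prop :=
  (∀ x, (x, true) ∈ T → x ∈ L) ∧ (∀ x, (x, false) ∈ T → x ∉ L)

/-- `T` is a teaching set for `L` with respect to the concept class `C`: `L` is consistent with `T`
and no other concept of `C` is. -/
def IsTeachingSet (T : LabeledSet X) (L : Set X) (C : Set (Set X)) : Prop :=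
  Consistent L T ∧ ∀ L' ∈ C, Consistent L' T → L' = L

/-- `T` has no negatively labeled example. -/
def IsPositive (T : LabeledSet X) : Prop := ∀ x, (x, false) ∉ T

/-- `r` is a strict partial order on the concept class `C` (values of `r` outside `C` are
irrelevant). -/
def IsStrictPartialOrderOn (C : Set (Set X)) (r : Set X → Set X → Prop) : Prop :=
  (∀ A ∈ C, ∀ B ∈ C, r A B → ¬ r B A) ∧
  (∀ A ∈ C, ∀ B ∈ C, ∀ D ∈ C, r A B → r B D → r A D)

/-- The concepts of `C` over which `L` is strictly preferred; `r L' L` reads `L' ≺ L`. -/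
def lessPreferred (C : Set (Set X)) (r : Set X → Set X → Prop) (L : Set X) : Set (Set X) :=
  {L' | L' ∈ C ∧ r L' L}

/-- `T` is a teaching set for `L` with respect to the pair `(C, r)`. -/
def IsPrefTeachingSet (T : LabeledSet X) (L : Set X) (C : Set (Set X))
    (r : Set X → Set X → Prop) : Prop :=
  IsTeachingSet T L (C \ lessPreferred C r L)

/-- The smallest size of a teaching set for `L` with respect to `(C, r)`. -/
noncomputable def prefTD (L : Set X) (C : Set (Set X)) (r : Set X → Set X → Prop) : ℕ∞ :=
  ⨅ (T : LabeledSet X) (_ : IsPrefTeachingSet T L C r), T.encard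

/-- The smallest size of a positive teaching set for `L` with respect to `(C, r)`. -/
noncomputable def posPrefTD (L : Set X) (C : Set (Set X)) (r : Set X → Set X → Prop) : ℕ∞ :=
  ⨅ (T : LabeledSet X) (_ : IsPrefTeachingSet T L C r ∧ IsPositive T), T.encard

/-- The preference-based teaching dimension of `C`. -/
noncomputable def PBTD (C : Set (Set X)) : ℕ∞ :=
  ⨅ (r : Set X → Set X → Prop) (_ : IsStrictPartialOrderOn C r), ⨆ L ∈ C, prefTD L C r

/-- The positive preference-based teaching dimension of `C`. -/
noncomputable def posPBTD (C : Set (Set X)) : ℕ∞ :=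
  ⨅ (r : Set X → Set X → Prop) (_ : IsStrictPartialOrderOn C r), ⨆ L ∈ C, posPrefTD L C r

end General

/-- All linear combinations of the elements of `G` with coefficients in `ℕ₀`. -/
def linSpan (G : Finset ℕ) : Set ℕ :=
  {n | ∃ a : ℕ → ℕ, n = ∑ g ∈ G, a g * g}

/-- All linear combinations of the elements of `G` with positive integer coefficients. -/
def linSpanPos (G : Finset ℕ) : Set ℕ :=
  {n | ∃ a : ℕ → ℕ, (∀ g ∈ G, 0 < a g) ∧ n = ∑ g ∈ G, a g * g}

/-- `G` is a set of positive integers with `1 ≤ |G| ≤ k`. -/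
def IsGenSet (k : ℕ) (G : Finset ℕ) : Prop :=
  (∀ g ∈ G, 0 < g) ∧ 1 ≤ G.card ∧ G.card ≤ k

def LINSET (k : ℕ) : Set (Set ℕ) :=
  {L | ∃ G : Finset ℕ, IsGenSet k G ∧ L = linSpan G}

def CFLINSET (k : ℕ) : Set (Set ℕ) :=
  {L | ∃ G : Finset ℕ, IsGenSet k G ∧ G.gcd id = 1 ∧ L = linSpan G}

def NELINSET (k : ℕ) : Set (Set ℕ) :=
  {L | ∃ G : Finset ℕ, IsGenSet k G ∧ L = linSpanPos G}

def NECFLINSET (k : ℕ) : Set (Set ℕ) :=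
  {L | ∃ G : Finset ℕ, IsGenSet k G ∧ G.gcd id = 1 ∧ L = linSpanPos G}

/-- The class of all `c + L` with `c ∈ ℕ₀` and `L ∈ C`. -/
def shiftExtension (C : Set (Set ℕ)) : Set (Set ℕ) :=
  {S | ∃ c : ℕ, ∃ L ∈ C, S = (fun x => c + x) '' L}

end Teaching

/-! Upper bounds use one preference, `lexLess`: the concept owning the least point of difference is
the less preferred one, so a proper superset always loses, and positive examples that force
inclusion teach. Generators suffice for `LINSET`; shifting costs one more example, the offset. For
⟨G⟩₊ the example ∑G fixes the offset, so one generator must be saved: a redundant one, or else the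
largest, which `mem_of_closure_eq_below` recovers from the sum.

Lower bounds use the semigroups {0, p} ∪ S ∪ [2p, ∞) with S ⊆ (p, 2p) arbitrary. Each has p
generators, so they form a cube of dimension p - 1, to which `card_le_PBTD_of_cube` applies. For
positive teaching, the top of the cube, {0} ∪ [p, ∞), has enough subconcepts missing single points
for `card_le_posPBTD`. With positive coefficients the offset ∑G depends on S: free shifts level it,
and without them one redundant generator does (`image_cube_mem_NECFLINSET`). -/

namespace Teaching

/-! ### General bounds on preference-based teaching dimensions. -/

section Bounds

variable {X : Type*}

theorem PBTD_mono {C D : Set (Set X)} (h : C ⊆ D) : PBTD C ≤ PBTD D := by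
  refine le_iInf₂ fun r hr => ?_
  refine iInf₂_le_of_le r ⟨fun A hA B hB => hr.1 A (h hA) B (h hB),
    fun A hA B hB E hE => hr.2 A (h hA) B (h hB) E (h hE)⟩ ?_
  refine iSup₂_le fun L hL => le_iSup₂_of_le L (h hL) ?_
  refine le_iInf₂ fun T hT => iInf₂_le T ⟨hT.1, fun L' hL' => hT.2 L' ⟨h hL'.1, fun h' => ?_⟩⟩
  exact hL'.2 ⟨hL'.1, h'.2⟩

theorem posPBTD_mono {C D : Set (Set X)} (h : C ⊆ D) : posPBTD C ≤ posPBTD D := by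
  refine le_iInf₂ fun r hr => ?_
  refine iInf₂_le_of_le r ⟨fun A hA B hB => hr.1 A (h hA) B (h hB),
    fun A hA B hB E hE => hr.2 A (h hA) B (h hB) E (h hE)⟩ ?_
  refine iSup₂_le fun L hL => le_iSup₂_of_le L (h hL) ?_
  refine le_iInf₂ fun T hT =>
    iInf₂_le T ⟨⟨hT.1.1, fun L' hL' => hT.1.2 L' ⟨h hL'.1, fun h' => ?_⟩⟩, hT.2⟩
  exact hL'.2 ⟨hL'.1, h'.2⟩

theorem PBTD_le_posPBTD (C : Set (Set X)) : PBTD C ≤ posPBTD C :=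
  iInf₂_mono fun _ _ => iSup₂_mono fun _ _ => le_iInf₂ fun T hT => iInf₂_le T hT.1

/-- If any fewer than `m` elements of `L` lie in a proper subconcept of `L`, then positive
preference-based teaching needs `m` examples. -/
theorem le_posPBTD_of_forall_subset {C : Set (Set X)} {L : Set X} (hL : L ∈ C) {m : ℕ∞}
    (h : ∀ T ⊆ L, T.encard < m → ∃ L' ∈ C, T ⊆ L' ∧ L' ⊂ L) : m ≤ posPBTD C := by
  refine le_iInf₂ fun r hr => ?_
  by_contra! hlt
  have key : ∀ L ∈ C, ∃ T : Set X, T ⊆ L ∧ T.encard < m ∧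
      ∀ L' ∈ C, T ⊆ L' → L' ≠ L → r L' L := by
    intro L hL
    have h1 : posPrefTD L C r < m := lt_of_le_of_lt (le_iSup₂_of_le L hL le_rfl) hlt
    simp only [posPrefTD, iInf_lt_iff, exists_prop] at h1
    obtain ⟨T, hT, hTm⟩ := h1
    refine ⟨Prod.fst '' T, ?_, (Set.encard_image_le _ _).trans_lt hTm, ?_⟩
    · rintro _ ⟨⟨x, b⟩, hx, rfl⟩
      cases b
      · exact absurd hx (hT.2 x)
      · exact hT.1.1.1 x hx
    · intro L' hL' hTL' hne
      by_contra hr'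
      refine hne (hT.1.2 L' ⟨hL', fun hl => hr' hl.2⟩ ⟨fun x hx => hTL' ⟨_, hx, rfl⟩, ?_⟩)
      exact fun x hx => absurd hx (hT.2 x)
  obtain ⟨T, hTL, hTm, hT⟩ := key L hL
  obtain ⟨L₁, hL₁, hTL₁, hss⟩ := h T hTL hTm
  obtain ⟨T₁, hTL₁', -, hT₁⟩ := key L₁ hL₁
  -- `L₁` fits the examples `T` of `L`, so `L₁ ≺ L`; the examples of `L₁` lie in `L`, so `L ≺ L₁`.
  exact hr.1 _ hL₁ _ hL (hT L₁ hL₁ hTL₁ hss.ne) (hT₁ L hL (hTL₁'.trans hss.subset) hss.ne')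

/-- A set `T` that omits some `x ≠ x₀` of `S` survives in `L \ {x}`. Otherwise its size forces `T =
S \ {x₀}`, which survives in `L'`; thus `L \ {x₀}` itself need not be a concept. -/
theorem card_le_posPBTD {C : Set (Set X)} {L : Set X} (hL : L ∈ C) (S : Finset X) (hS : ↑S ⊆ L)
    (x₀ : X) (hx₀ : x₀ ∈ S) (h : ∀ x ∈ S, x ≠ x₀ → L \ {x} ∈ C)
    (h₀ : ∃ L' ∈ C, (∀ x ∈ S, x ≠ x₀ → x ∈ L') ∧ L' ⊂ L) : (S.card : ℕ∞) ≤ posPBTD C := by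
  classical
  refine le_posPBTD_of_forall_subset hL fun T hTL hT => ?_
  by_cases hx : ∃ x ∈ S, x ≠ x₀ ∧ x ∉ T
  · obtain ⟨x, hxS, hne, hxT⟩ := hx
    refine ⟨_, h x hxS hne, fun y hy => ⟨hTL hy, ?_⟩, Set.sdiff_subset, fun h' => ?_⟩
    · rintro rfl
      exact hxT hy
    · exact (h' (hS hxS)).2 rfl
  · push Not at hx
    obtain ⟨L', hL', hsub, hss⟩ := h₀
    refine ⟨L', hL', ?_, hss⟩
    have hfin : T.Finite := Set.finite_of_encard_le_coe hT.le
    have hsT : (↑(S.erase x₀) : Set X) ⊆ T := fun x hx' => by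
      rw [Finset.mem_coe, Finset.mem_erase] at hx'
      exact hx x hx'.2 hx'.1
    have hle : T.encard ≤ (↑(S.erase x₀) : Set X).encard := by
      rw [Set.encard_coe_eq_coe_finsetCard, Finset.card_erase_of_mem hx₀]
      lift T to Finset X using hfin
      rw [Set.encard_coe_eq_coe_finsetCard] at hT ⊢
      norm_cast at hT ⊢
      omega
    rw [← (Finset.finite_toSet _).eq_of_subset_of_encard_le hsT hle]
    intro x hx'
    rw [Finset.mem_coe, Finset.mem_erase] at hx'
    exact hsub x hx'.2 hx'.1

/-- A class containing a cube of dimension `S.card` has at least that teaching dimension. -/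
theorem card_le_PBTD_of_cube {C : Set (Set X)} (B : Set X) (S : Finset X) (hBS : ∀ x ∈ S, x ∉ B)
    (h : ∀ U ⊆ S, B ∪ ↑U ∈ C) : (S.card : ℕ∞) ≤ PBTD C := by
  classical
  refine le_iInf₂ fun r hr => ?_
  by_contra! hlt
  -- No member of the cube is discarded in favour of a minimal one, so its teaching set must
  -- separate it from the whole cube.
  obtain ⟨U, hU, hmin⟩ : ∃ U ∈ S.powerset, ∀ V ∈ S.powerset, ¬ r (B ∪ ↑V) (B ∪ ↑U) := by
    let F : Finset (Set X) := S.powerset.image fun U : Finset X => B ∪ ↑U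
    have hF : ∀ A ∈ F, A ∈ C := by
      intro A hA
      obtain ⟨U, hU, rfl⟩ := Finset.mem_image.1 hA
      exact h U (Finset.mem_powerset.1 hU)
    let r' : F → F → Prop := fun A D => r A D
    have : IsTrans F r' := ⟨fun A D E => hr.2 A (hF _ A.2) D (hF _ D.2) E (hF _ E.2)⟩
    have : Std.Irrefl r' := ⟨fun A hA => hr.1 A (hF _ A.2) A (hF _ A.2) hA hA⟩
    have hwf : WellFounded r' := Finite.wellFounded_of_trans_of_irrefl r'
    obtain ⟨A, -, hA⟩ := hwf.has_min Set.univ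
      ⟨⟨B ∪ ↑(∅ : Finset X), Finset.mem_image.2 ⟨∅, by simp, rfl⟩⟩, trivial⟩
    obtain ⟨U, hU, hUA⟩ := Finset.mem_image.1 A.2
    refine ⟨U, hU, fun V hV hr' => hA ⟨B ∪ ↑V, Finset.mem_image.2 ⟨V, hV, rfl⟩⟩ trivial ?_⟩
    change r _ _
    rw [← hUA]
    exact hr'
  rw [Finset.mem_powerset] at hU
  have h1 : prefTD (B ∪ ↑U) C r < S.card :=
    lt_of_le_of_lt (le_iSup₂_of_le (f := fun L (_ : L ∈ C) => prefTD L C r) _ (h U hU) le_rfl) hlt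
  simp only [prefTD, iInf_lt_iff, exists_prop] at h1
  obtain ⟨T, hT, hTm⟩ := h1
  obtain ⟨x, hxS, hx⟩ : ∃ x ∈ S, x ∉ Prod.fst '' T := by
    by_contra! hc
    have := Set.encard_le_encard (s := (S : Set X)) (t := Prod.fst '' T) fun x hx => hc x hx
    rw [Set.encard_coe_eq_coe_finsetCard] at this
    exact absurd (this.trans (Set.encard_image_le _ _)) (not_le.2 hTm)
  have hxT : ∀ y b, (y, b) ∈ T → y ≠ x := by
    rintro y b hy rfl
    exact hx ⟨_, hy, rfl⟩
  -- Changing membership of the unmentioned point `x` preserves consistency.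
  have hflip : ∀ V ⊆ S, (∀ y, y ≠ x → (y ∈ V ↔ y ∈ U)) → V = U := by
    intro V hV hVU
    have hcons : ∀ y, y ≠ x → (y ∈ B ∪ (↑V : Set X) ↔ y ∈ B ∪ (↑U : Set X)) := by
      intro y hy
      simp [hVU y hy]
    have heq := hT.2 (B ∪ ↑V) ⟨h V hV, fun hl => hmin V (Finset.mem_powerset.2 hV) hl.2⟩
      ⟨fun y hy => (hcons y (hxT _ _ hy)).2 (hT.1.1 y hy),
       fun y hy => fun hy' => hT.1.2 y hy ((hcons y (hxT _ _ hy)).1 hy')⟩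
    ext y
    by_cases hy : y = x
    · subst hy
      have := Set.ext_iff.1 heq y
      simpa [hBS y hxS] using this
    · exact hVU y hy
  by_cases hxU : x ∈ U
  · have := hflip (U.erase x) ((Finset.erase_subset _ _).trans hU) (fun y hy => by simp [hy])
    rw [← this] at hxU
    simp at hxU
  · have := hflip (insert x U) (Finset.insert_subset hxS hU) (fun y hy => by simp [hy])
    rw [← this] at hxU
    simp at hxU

end Bounds

/-! ### The lexicographic preference. -/

/-- `lexLess A B` says that the least element in which `A` and `B` differ belongs to `A`. -/
def lexLess (A B : Set ℕ) : Prop := ∃ x ∈ A, x ∉ B ∧ ∀ y < x, y ∈ A ↔ y ∈ B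

theorem isStrictPartialOrderOn_lexLess (C : Set (Set ℕ)) : IsStrictPartialOrderOn C lexLess := by
  constructor
  · rintro A - B - ⟨x, hxA, hxB, hx⟩ ⟨y, hyB, hyA, hy⟩
    rcases lt_trichotomy x y with h | rfl | h
    · exact hxB ((hy x h).2 hxA)
    · exact hxB hyB
    · exact hyA ((hx y h).2 hyB)
  · rintro A - B - D - ⟨x, hxA, hxB, hx⟩ ⟨y, hyB, hyD, hy⟩
    rcases lt_trichotomy x y with h | rfl | h
    · exact ⟨x, hxA, fun h' => hxB ((hy x h).2 h'),
        fun z hz => (hx z hz).trans (hy z (hz.trans h))⟩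
    · exact absurd hyB hxB
    · exact ⟨y, (hx y h).2 hyB, hyD, fun z hz => (hx z (hz.trans h)).trans (hy z hz)⟩

theorem lexLess_or_lexLess_of_ne {A B : Set ℕ} (h : A ≠ B) : lexLess A B ∨ lexLess B A := by
  classical
  have hex : ∃ x, ¬ (x ∈ A ↔ x ∈ B) := by
    by_contra! hc
    exact h (Set.ext hc)
  have hmin : ∀ y < Nat.find hex, (y ∈ A ↔ y ∈ B) := fun y hy => not_not.1 (Nat.find_min hex hy)
  have hspec := Nat.find_spec hex
  by_cases hA : Nat.find hex ∈ A
  · exact Or.inl ⟨_, hA, fun hB => hspec ⟨fun _ => hB, fun _ => hA⟩, hmin⟩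
  · refine Or.inr ⟨Nat.find hex, ?_, hA, fun y hy => (hmin y hy).symm⟩
    by_contra hB
    exact hspec ⟨fun h => absurd h hA, fun h => absurd h hB⟩

/-- The least difference cannot lie in the smaller set, so teaching reduces to forcing an inclusion.
-/
theorem eq_or_lexLess_of_subset {A B : Set ℕ} (h : A ⊆ B) : B = A ∨ lexLess B A := by
  by_cases he : B = A
  · exact Or.inl he
  · rcases lexLess_or_lexLess_of_ne he with h' | ⟨x, hx, hx', -⟩
    · exact Or.inr h'
    · exact absurd (h hx) hx'

theorem posPBTD_le {C : Set (Set ℕ)} {m : ℕ} (h : ∀ L ∈ C, ∃ T : Finset ℕ, ↑T ⊆ L ∧ T.card ≤ m ∧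
    ∀ L' ∈ C, ↑T ⊆ L' → L' = L ∨ lexLess L' L) : posPBTD C ≤ m := by
  refine iInf₂_le_of_le lexLess (isStrictPartialOrderOn_lexLess C) (iSup₂_le fun L hL => ?_)
  obtain ⟨T, hTL, hTm, hT⟩ := h L hL
  refine iInf₂_le_of_le ((fun x => (x, true)) '' (T : Set ℕ)) ⟨⟨⟨?_, ?_⟩, ?_⟩, ?_⟩ ?_
  · rintro x ⟨y, hy, hxy⟩
    cases hxy
    exact hTL hy
  · rintro x ⟨y, hy, hxy⟩
    cases hxy
  · intro L' hL' hc
    refine (hT L' hL'.1 fun x hx => hc.1 x ⟨x, hx, rfl⟩).resolve_right fun hl => ?_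
    exact hL'.2 ⟨hL'.1, hl⟩
  · rintro x ⟨y, hy, hxy⟩
    cases hxy
  · refine (Set.encard_image_le _ _).trans ?_
    rw [Set.encard_coe_eq_coe_finsetCard]
    exact_mod_cast hTm

/-! ### Linear sets as submonoids and their shifts. -/

theorem linSpan_eq_closure (G : Finset ℕ) :
    linSpan G = (AddSubmonoid.closure (G : Set ℕ) : Set ℕ) := by
  ext n
  rw [SetLike.mem_coe, AddSubmonoid.mem_closure_finset']
  constructor
  · rintro ⟨a, rfl⟩
    exact ⟨fun i => a i, by rw [Finset.sum_coe_sort G fun i => a i • i]; simp⟩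
  · rintro ⟨a, rfl⟩
    classical
    refine ⟨fun i => if h : i ∈ G then a ⟨i, h⟩ else 0, ?_⟩
    rw [← Finset.sum_coe_sort G]
    simp

theorem linSpanPos_eq_image (G : Finset ℕ) :
    linSpanPos G = (fun x => ∑ g ∈ G, g + x) '' linSpan G := by
  ext n
  constructor
  · rintro ⟨a, ha, rfl⟩
    refine ⟨_, ⟨fun g => a g - 1, rfl⟩, ?_⟩
    change ∑ g ∈ G, g + ∑ g ∈ G, (a g - 1) * g = _
    rw [← Finset.sum_add_distrib]
    refine Finset.sum_congr rfl fun g hg => ?_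
    obtain ⟨b, hb⟩ := Nat.exists_eq_succ_of_ne_zero (ha g hg).ne'
    rw [hb, Nat.succ_sub_one, Nat.succ_mul, add_comm]
  · rintro ⟨_, ⟨a, rfl⟩, rfl⟩
    refine ⟨fun g => a g + 1, fun g _ => Nat.succ_pos _, ?_⟩
    change ∑ g ∈ G, g + ∑ g ∈ G, a g * g = _
    rw [← Finset.sum_add_distrib]
    exact Finset.sum_congr rfl fun g _ => by ring

theorem mem_linSpanPos {G : Finset ℕ} {n : ℕ} :
    n ∈ linSpanPos G ↔ ∃ x ∈ AddSubmonoid.closure (G : Set ℕ), ∑ g ∈ G, g + x = n := by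
  rw [linSpanPos_eq_image, linSpan_eq_closure]
  rfl

theorem add_mem_linSpanPos {G : Finset ℕ} {x : ℕ} :
    ∑ g ∈ G, g + x ∈ linSpanPos G ↔ x ∈ AddSubmonoid.closure (G : Set ℕ) := by
  rw [mem_linSpanPos]
  constructor
  · rintro ⟨y, hy, h⟩
    rwa [← Nat.add_left_cancel h]
  · exact fun h => ⟨x, h, rfl⟩

theorem CFLINSET_subset_LINSET (k : ℕ) : CFLINSET k ⊆ LINSET k :=
  fun _ ⟨G, hG, _, h⟩ => ⟨G, hG, h⟩

theorem NECFLINSET_subset_NELINSET (k : ℕ) : NECFLINSET k ⊆ NELINSET k :=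
  fun _ ⟨G, hG, _, h⟩ => ⟨G, hG, h⟩

theorem shiftExtension_mono {C D : Set (Set ℕ)} (h : C ⊆ D) :
    shiftExtension C ⊆ shiftExtension D :=
  fun _ ⟨c, L, hL, e⟩ => ⟨c, L, h hL, e⟩

theorem shiftExtension_shiftExtension (C : Set (Set ℕ)) :
    shiftExtension (shiftExtension C) ⊆ shiftExtension C := by
  rintro _ ⟨c, _, ⟨d, L, hL, rfl⟩, rfl⟩
  refine ⟨c + d, L, hL, ?_⟩
  rw [Set.image_image]
  simp only [add_assoc]

theorem NELINSET_subset_shiftExtension (k : ℕ) : NELINSET k ⊆ shiftExtension (LINSET k) := by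
  rintro _ ⟨G, hG, rfl⟩
  exact ⟨∑ g ∈ G, g, _, ⟨G, hG, rfl⟩, linSpanPos_eq_image G⟩

theorem NECFLINSET_subset_shiftExtension (k : ℕ) :
    NECFLINSET k ⊆ shiftExtension (CFLINSET k) := by
  rintro _ ⟨G, hG, h1, rfl⟩
  exact ⟨∑ g ∈ G, g, _, ⟨G, hG, h1, rfl⟩, linSpanPos_eq_image G⟩

theorem shiftExtension_NELINSET_subset (k : ℕ) :
    shiftExtension (NELINSET k) ⊆ shiftExtension (LINSET k) :=
  (shiftExtension_mono (NELINSET_subset_shiftExtension k)).trans (shiftExtension_shiftExtension _)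

theorem shiftExtension_NECFLINSET_subset (k : ℕ) :
    shiftExtension (NECFLINSET k) ⊆ shiftExtension (CFLINSET k) :=
  (shiftExtension_mono (NECFLINSET_subset_shiftExtension k)).trans
    (shiftExtension_shiftExtension _)

/-! ### Upper bounds. -/

theorem posPBTD_LINSET_le (k : ℕ) : posPBTD (LINSET k) ≤ k := by
  refine posPBTD_le ?_
  rintro _ ⟨G, hG, rfl⟩
  refine ⟨G, ?_, hG.2.2, ?_⟩
  · rw [linSpan_eq_closure]
    exact AddSubmonoid.subset_closure
  · rintro _ ⟨G', -, rfl⟩ h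
    refine eq_or_lexLess_of_subset ?_
    rw [linSpan_eq_closure] at h ⊢
    rw [linSpan_eq_closure]
    exact AddSubmonoid.closure_le.2 h

theorem posPBTD_shiftExtension_LINSET_le (k : ℕ) :
    posPBTD (shiftExtension (LINSET k)) ≤ (k + 1 : ℕ) := by
  classical
  refine posPBTD_le ?_
  rintro _ ⟨c, _, ⟨G, hG, rfl⟩, rfl⟩
  rw [linSpan_eq_closure]
  refine ⟨(insert 0 G).image fun x => c + x, ?_, ?_, ?_⟩
  · rw [Finset.coe_image, Finset.coe_insert]
    exact Set.image_mono (Set.insert_subset (zero_mem _) AddSubmonoid.subset_closure)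
  · exact Finset.card_image_le.trans ((Finset.card_insert_le _ _).trans (by have := hG.2.2; omega))
  · rintro _ ⟨c', _, ⟨G', -, rfl⟩, rfl⟩ h
    rw [linSpan_eq_closure] at h ⊢
    have hc' : c' ≤ c := by
      obtain ⟨y, -, hy⟩ := h (show c ∈ _ by simp)
      dsimp only at hy
      omega
    -- A smaller offset is itself the least point of difference, which makes the competitor less
    -- preferred.
    rcases hc'.lt_or_eq with hlt | rfl
    · refine Or.inr ⟨c', ⟨0, zero_mem _, rfl⟩, ?_, fun y hy => ⟨?_, ?_⟩⟩
      · rintro ⟨y, -, hy⟩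
        dsimp only at hy
        omega
      · rintro ⟨z, -, hz⟩
        dsimp only at hz
        omega
      · rintro ⟨z, -, hz⟩
        dsimp only at hz
        omega
    · refine eq_or_lexLess_of_subset (Set.image_mono (AddSubmonoid.closure_le.2 fun g hg => ?_))
      obtain ⟨y, hy, hyg⟩ := h (show c' + g ∈ _ by simp [Finset.mem_coe.1 hg])
      rwa [← Nat.add_left_cancel hyg]

/-- A sum of naturals below `g` cannot have `g` as a summand. -/
theorem mem_closure_diff_of_lt {G : Set ℕ} {x g : ℕ} (hx : x ∈ AddSubmonoid.closure G)
    (h : x < g) : x ∈ AddSubmonoid.closure (G \ {g}) := by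
  induction hx using AddSubmonoid.closure_induction with
  | mem x hx => exact AddSubmonoid.subset_closure ⟨hx, h.ne⟩
  | zero => exact zero_mem _
  | add x y _ _ ihx ihy => exact add_mem (ihx (by omega)) (ihy (by omega))

theorem eq_zero_or_mem_or_eq_add_of_mem_closure {G : Set ℕ} {x : ℕ}
    (hx : x ∈ AddSubmonoid.closure G) :
    x = 0 ∨ x ∈ G ∨ ∃ y ∈ AddSubmonoid.closure G, ∃ z ∈ AddSubmonoid.closure G,
      y < x ∧ z < x ∧ y + z = x := by
  induction hx using AddSubmonoid.closure_induction with
  | mem x hx => exact Or.inr (Or.inl hx)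
  | zero => exact Or.inl rfl
  | add x y hx hy ihx ihy =>
    rcases Nat.eq_zero_or_pos x with rfl | hx0
    · simpa using ihy
    · rcases Nat.eq_zero_or_pos y with rfl | hy0
      · simpa using ihx
      · exact Or.inr (Or.inr ⟨x, hx, y, hy, by omega, by omega, rfl⟩)

/-- An irredundant generating set is recovered, among generating sets that are not larger and have
the same sum, from the part of its span below its maximum. -/
theorem mem_of_closure_eq_below {G G' : Finset ℕ} {m : ℕ} (hm : m ∈ G) (hm0 : 0 < m)
    (hmax : ∀ g ∈ G, g ≤ m) (hirr : ∀ g ∈ G, g ∉ AddSubmonoid.closure ((G : Set ℕ) \ {g}))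
    (hcard : G'.card ≤ G.card) (hsum : ∑ g ∈ G', g = ∑ g ∈ G, g)
    (h : ∀ y < m, y ∈ AddSubmonoid.closure (G' : Set ℕ) ↔ y ∈ AddSubmonoid.closure (G : Set ℕ)) :
    m ∈ G' := by
  have hsub : G.erase m ⊆ G' := by
    intro g hg
    rw [Finset.mem_erase] at hg
    have hgm : g < m := lt_of_le_of_ne (hmax g hg.2) hg.1
    rcases eq_zero_or_mem_or_eq_add_of_mem_closure
      ((h g hgm).2 (AddSubmonoid.subset_closure hg.2)) with
      rfl | hg' | ⟨y, hy, z, hz, hyg, hzg, hyz⟩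
    · exact absurd (zero_mem _) (hirr _ hg.2)
    · exact hg'
    · refine absurd ?_ (hirr g hg.2)
      rw [← hyz] at hgm
      have := add_mem (mem_closure_diff_of_lt ((h y (by omega)).1 hy) hyg)
        (mem_closure_diff_of_lt ((h z (by omega)).1 hz) hzg)
      rwa [hyz] at this
  -- `G'` has at most one element outside `G.erase m`, and by equality of sums these leftovers add
  -- up to `m > 0`.
  have h1 := Finset.card_sdiff_add_card_eq_card hsub
  have h2 := Finset.sum_sdiff (f := fun g : ℕ => g) hsub
  have h3 := Finset.add_sum_erase G (fun g : ℕ => g) hm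
  have h4 := Finset.card_erase_add_one hm
  rcases Nat.lt_or_ge 0 (G' \ G.erase m).card with h5 | h5
  · obtain ⟨w, hw⟩ := Finset.card_eq_one.1 (show (G' \ G.erase m).card = 1 by omega)
    rw [hw, Finset.sum_singleton] at h2
    have hwm : w = m := by
      omega
    have : w ∈ G' \ G.erase m := by simp [hw]
    rw [← hwm]
    exact (Finset.mem_sdiff.1 this).1
  · rw [Finset.card_eq_zero.1 (show (G' \ G.erase m).card = 0 by omega), Finset.sum_empty] at h2
    omega

theorem posPBTD_NELINSET_le (k : ℕ) : posPBTD (NELINSET k) ≤ k := by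
  classical
  refine posPBTD_le ?_
  rintro _ ⟨G, hG, rfl⟩
  -- One example is spent on the offset `∑ G`, so `U` may contain at most `k - 1` generators.
  obtain ⟨U, hUG, hUk, hU⟩ : ∃ U ⊆ G, U.card + 1 ≤ k ∧ ∀ G' : Finset ℕ, G'.card ≤ k →
      ∑ g ∈ G', g = ∑ g ∈ G, g → (∀ u ∈ U, u ∈ AddSubmonoid.closure (G' : Set ℕ)) →
      linSpanPos G' = linSpanPos G ∨ lexLess (linSpanPos G') (linSpanPos G) := by
    have hle : ∀ G' : Finset ℕ, ∑ g ∈ G', g = ∑ g ∈ G, g →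
        (∀ g ∈ G, g ∈ AddSubmonoid.closure (G' : Set ℕ)) →
        linSpanPos G' = linSpanPos G ∨ lexLess (linSpanPos G') (linSpanPos G) := by
      intro G' hsum h
      refine eq_or_lexLess_of_subset ?_
      rw [linSpanPos_eq_image, linSpanPos_eq_image, hsum, linSpan_eq_closure, linSpan_eq_closure]
      exact Set.image_mono (AddSubmonoid.closure_le.2 h)
    rcases hG.2.2.lt_or_eq with hlt | heq
    · exact ⟨G, subset_rfl, hlt, fun G' _ => hle G'⟩
    · by_cases hred : ∃ g ∈ G, g ∈ AddSubmonoid.closure ((G : Set ℕ) \ {g})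
      · obtain ⟨g, hg, hgc⟩ := hred
        refine ⟨G.erase g, Finset.erase_subset _ _, ?_, fun G' _ hsum h => hle G' hsum ?_⟩
        · rw [Finset.card_erase_add_one hg, heq]
        · intro x hx
          by_cases hxg : x = g
          · subst hxg
            refine AddSubmonoid.closure_le.2 (fun y hy => h y ?_) hgc
            exact Finset.mem_erase.2 ⟨hy.2, hy.1⟩
          · exact h x (Finset.mem_erase.2 ⟨hxg, hx⟩)
      · push Not at hred
        have hne : G.Nonempty := Finset.card_pos.1 hG.2.1
        have hmax : ∀ g ∈ G, g ≤ G.max' hne := fun g hg => G.le_max' g hg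
        have hmem : G.max' hne ∈ G := G.max'_mem hne
        generalize G.max' hne = m at hmax hmem
        refine ⟨G.erase m, Finset.erase_subset _ _, ?_, fun G' hk hsum h => ?_⟩
        · rw [Finset.card_erase_add_one hmem, heq]
        by_cases heq' : linSpanPos G' = linSpanPos G
        · exact Or.inl heq'
        rcases lexLess_or_lexLess_of_ne heq' with hlex | ⟨n, hn, hn', hlt⟩
        · exact Or.inr hlex
        by_cases hmG' : m ∈ AddSubmonoid.closure (G' : Set ℕ)
        · refine hle G' hsum fun g hg => ?_
          by_cases hgm : g = m
          · rwa [hgm]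
          · exact h g (Finset.mem_erase.2 ⟨hgm, hg⟩)
        exfalso
        -- If the least difference belonged to ⟨G⟩₊, it would be `∑ G + x` with `m ≤ x`, since below
        -- `m` only `G.erase m` contributes. The closures then agree below `m`, which puts `m` in
        -- `G'`.
        obtain ⟨x, hx, rfl⟩ := mem_linSpanPos.1 hn
        rw [← hsum, add_mem_linSpanPos] at hn'
        have hmx : m ≤ x := by
          by_contra! hc
          refine hn' (AddSubmonoid.closure_le.2 (fun y hy => h y ?_) (mem_closure_diff_of_lt hx hc))
          exact Finset.mem_erase.2 ⟨hy.2, hy.1⟩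
        refine hmG' (AddSubmonoid.subset_closure (mem_of_closure_eq_below hmem
          (hG.1 m hmem) hmax hred (hk.trans heq.ge) hsum fun y hy => ?_))
        have := hlt (∑ g ∈ G, g + y) (by omega)
        rw [add_mem_linSpanPos, ← hsum, add_mem_linSpanPos] at this
        exact this.symm
  refine ⟨(insert 0 U).image fun x => ∑ g ∈ G, g + x, ?_, ?_, ?_⟩
  · rw [linSpanPos_eq_image, linSpan_eq_closure, Finset.coe_image, Finset.coe_insert]
    exact Set.image_mono (Set.insert_subset (zero_mem _)
      ((Finset.coe_subset.2 hUG).trans AddSubmonoid.subset_closure))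
  · exact Finset.card_image_le.trans ((Finset.card_insert_le _ _).trans hUk)
  · rintro _ ⟨G', hG', rfl⟩ h
    have hsum : ∑ g ∈ G', g ≤ ∑ g ∈ G, g := by
      obtain ⟨y, -, hy⟩ := mem_linSpanPos.1 (h (show ∑ g ∈ G, g ∈ _ by simp))
      omega
    rcases hsum.lt_or_eq with hlt | heq
    · refine Or.inr ⟨∑ g ∈ G', g, mem_linSpanPos.2 ⟨0, zero_mem _, rfl⟩, ?_, fun y hy => ⟨?_, ?_⟩⟩
      · intro hy
        obtain ⟨z, -, hz⟩ := mem_linSpanPos.1 hy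
        omega
      · intro hy
        obtain ⟨z, -, hz⟩ := mem_linSpanPos.1 hy
        omega
      · intro hy
        obtain ⟨z, -, hz⟩ := mem_linSpanPos.1 hy
        omega
    · refine hU G' hG'.2.2 heq fun u hu => ?_
      have := h (show ∑ g ∈ G, g + u ∈ _ by simp [hu])
      rwa [← heq, add_mem_linSpanPos] at this

/-! ### A cube of numerical semigroups. -/

/-- The part of a numerical semigroup of multiplicity `p` containing all `n ≥ 2 * p` that does not
depend on which elements strictly between `p` and `2 * p` it contains. -/
def cubeBase (p : ℕ) : Set ℕ := {n | n = 0 ∨ n = p ∨ 2 * p ≤ n}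

/-- `p` generators of `cubeBase p ∪ S`. -/
def cubeGens (p : ℕ) (S : Finset ℕ) : Finset ℕ :=
  insert p (S ∪ (Finset.Ioo p (2 * p) \ S).image fun x => x + p)

theorem mem_cubeBase_union {p n : ℕ} {S : Finset ℕ} :
    n ∈ cubeBase p ∪ (S : Set ℕ) ↔ (n = 0 ∨ n = p ∨ 2 * p ≤ n) ∨ n ∈ S := Iff.rfl

theorem mem_cubeGens {p n : ℕ} {S : Finset ℕ} :
    n ∈ cubeGens p S ↔ n = p ∨ n ∈ S ∨ ∃ x, ((p < x ∧ x < 2 * p) ∧ x ∉ S) ∧ x + p = n := by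
  simp [cubeGens]

theorem card_cubeGens_le {p : ℕ} (hp : 0 < p) {S : Finset ℕ} (hS : S ⊆ Finset.Ioo p (2 * p)) :
    (cubeGens p S).card ≤ p := by
  have h1 := Finset.card_sdiff_add_card_eq_card hS
  have h2 := Finset.card_insert_le p (S ∪ (Finset.Ioo p (2 * p) \ S).image fun x => x + p)
  have h3 := Finset.card_union_le S ((Finset.Ioo p (2 * p) \ S).image fun x => x + p)
  have h4 := Finset.card_image_le (s := Finset.Ioo p (2 * p) \ S) (f := fun x => x + p)
  rw [Nat.card_Ioo] at h1
  unfold cubeGens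
  omega

/-- The bound `3 * p` controls the sum of the generators; the divisibility clause ensures that a
further multiple of `p` is a new generator. -/
theorem le_of_mem_cubeGens {p : ℕ} {S : Finset ℕ} (hS : S ⊆ Finset.Ioo p (2 * p)) {g : ℕ}
    (hg : g ∈ cubeGens p S) : p ≤ g ∧ g ≤ 3 * p ∧ (p ∣ g → g = p) := by
  have key : ∀ x, p < x → x < 2 * p → ¬ p ∣ x := by
    rintro x h1 h2 ⟨c, rfl⟩
    have h3 : 1 < c := by
      by_contra! hc
      nlinarith
    have h4 : c < 2 := by
      by_contra! hc
      nlinarith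
    omega
  rcases mem_cubeGens.1 hg with rfl | h | ⟨x, ⟨hx, -⟩, rfl⟩
  · omega
  · have := Finset.mem_Ioo.1 (hS h)
    exact ⟨by omega, by omega, fun h' => absurd h' (key _ this.1 this.2)⟩
  · exact ⟨by omega, by omega, fun h' => absurd ((Nat.dvd_add_left dvd_rfl).1 h')
      (key _ hx.1 hx.2)⟩

theorem linSpan_eq_cube {p : ℕ} (hp : 0 < p) {S G : Finset ℕ} (hS : S ⊆ Finset.Ioo p (2 * p))
    (hG : cubeGens p S ⊆ G) (h : ∀ g ∈ G, g ∈ cubeBase p ∪ (S : Set ℕ)) :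
    linSpan G = cubeBase p ∪ (S : Set ℕ) := by
  rw [linSpan_eq_closure]
  refine Set.Subset.antisymm (fun n hn => ?_) fun n hn => ?_
  -- Two nonzero elements are both at least `p`, so their sum lies in the full tail.
  · have hadd : ∀ x y, x ∈ cubeBase p ∪ (S : Set ℕ) → y ∈ cubeBase p ∪ (S : Set ℕ) →
        x + y ∈ cubeBase p ∪ (S : Set ℕ) := by
      intro x y hx hy
      have hge : ∀ z, z ∈ cubeBase p ∪ (S : Set ℕ) → z = 0 ∨ p ≤ z := by
        rintro z (hz | hz)
        · rcases hz with hz | hz | hz <;> omega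
        · have := Finset.mem_Ioo.1 (hS hz)
          omega
      rcases hge x hx with rfl | hx'
      · simpa using hy
      · rcases hge y hy with rfl | hy'
        · simpa using hx
        · exact Or.inl (Or.inr (Or.inr (by omega)))
    induction hn using AddSubmonoid.closure_induction with
    | mem x hx => exact h x hx
    | zero => exact Or.inl (Or.inl rfl)
    | add x y _ _ hx hy => exact hadd x y hx hy
  · have hmem : ∀ x ∈ cubeGens p S, x ∈ AddSubmonoid.closure (G : Set ℕ) :=
      fun x hx => AddSubmonoid.subset_closure (hG hx)
    have hp' := hmem p (mem_cubeGens.2 (Or.inl rfl))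
    rcases hn with (rfl | rfl | hn) | hn
    · exact zero_mem _
    · exact hp'
    · have hmul : ∀ a, p * a ∈ AddSubmonoid.closure (G : Set ℕ) := fun a => by
        rw [mul_comm, ← smul_eq_mul]
        exact nsmul_mem hp' a
      have hdiv := Nat.div_add_mod n p
      have hlt := Nat.mod_lt n hp
      have hq : 2 ≤ n / p := (Nat.le_div_iff_mul_le hp).2 hn
      -- Now `n = p(q + 2) + r`. For `r > 0` the generator in the residue class of `r` is `p + r` or
      -- `2p + r`, and copies of `p` supply the rest.
      obtain ⟨q, hq⟩ := Nat.exists_eq_add_of_le' hq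
      rw [hq] at hdiv
      rcases Nat.eq_zero_or_pos (n % p) with h0 | h0
      · rw [← hdiv, h0]
        exact hmul _
      · by_cases hmS : p + n % p ∈ S
        · have h1 := add_mem (hmul (q + 1)) (hmem (p + n % p)
            (mem_cubeGens.2 (Or.inr (Or.inl hmS))))
          rwa [show p * (q + 1) + (p + n % p) = n by rw [← hdiv]; simp; ring] at h1
        · have h1 := add_mem (hmul q) (hmem (p + n % p + p)
            (mem_cubeGens.2 (Or.inr (Or.inr ⟨_, ⟨⟨by omega, by omega⟩, hmS⟩, rfl⟩))))
          rwa [show p * q + (p + n % p + p) = n by rw [← hdiv]; simp; ring] at h1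
    · exact hmem n (mem_cubeGens.2 (Or.inr (Or.inl hn)))

theorem gcd_eq_one_of_cubeGens_subset {p : ℕ} (hp : 0 < p) {S G : Finset ℕ}
    (hG : cubeGens p S ⊆ G) : G.gcd id = 1 := by
  have hd : ∀ x ∈ cubeGens p S, G.gcd id ∣ x := fun x hx => Finset.gcd_dvd (hG hx)
  have hdp := hd p (mem_cubeGens.2 (Or.inl rfl))
  rw [← Nat.dvd_one]
  rcases Nat.lt_or_ge 1 p with h1 | h1
  · by_cases hmS : p + 1 ∈ S
    · exact (Nat.dvd_add_right hdp).1 (hd (p + 1) (mem_cubeGens.2 (Or.inr (Or.inl hmS))))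
    · have := hd (p + 1 + p)
        (mem_cubeGens.2 (Or.inr (Or.inr ⟨_, ⟨⟨by omega, by omega⟩, hmS⟩, rfl⟩)))
      exact (Nat.dvd_add_right hdp).1 ((Nat.dvd_add_left hdp).1 this)
  · rwa [show p = 1 by omega] at hdp

theorem cubeGens_subset_cube {p : ℕ} {S : Finset ℕ} :
    ∀ g ∈ cubeGens p S, g ∈ cubeBase p ∪ (S : Set ℕ) := by
  intro g hg
  rw [mem_cubeBase_union]
  rcases mem_cubeGens.1 hg with rfl | h | ⟨x, ⟨hx, -⟩, rfl⟩
  · simp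
  · exact Or.inr h
  · exact Or.inl (Or.inr (Or.inr (by omega)))

theorem isGenSet_cubeGens {p : ℕ} (hp : 0 < p) {S : Finset ℕ} (hS : S ⊆ Finset.Ioo p (2 * p)) :
    IsGenSet p (cubeGens p S) :=
  ⟨fun _ hg => hp.trans_le (le_of_mem_cubeGens hS hg).1,
    Finset.card_pos.2 ⟨p, mem_cubeGens.2 (Or.inl rfl)⟩, card_cubeGens_le hp hS⟩

theorem cube_mem_CFLINSET {p : ℕ} (hp : 0 < p) {S : Finset ℕ} (hS : S ⊆ Finset.Ioo p (2 * p)) :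
    cubeBase p ∪ (S : Set ℕ) ∈ CFLINSET p :=
  ⟨cubeGens p S, isGenSet_cubeGens hp hS, gcd_eq_one_of_cubeGens_subset hp subset_rfl,
    (linSpan_eq_cube hp hS subset_rfl cubeGens_subset_cube).symm⟩

theorem image_linSpan_mem_shiftExtension {C : Set (Set ℕ)} {G : Finset ℕ} (hG : linSpanPos G ∈ C)
    {c : ℕ} (hc : ∑ g ∈ G, g ≤ c) : (fun x => c + x) '' linSpan G ∈ shiftExtension C := by
  refine ⟨c - ∑ g ∈ G, g, _, hG, ?_⟩
  rw [linSpanPos_eq_image, Set.image_image]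
  refine Set.image_congr fun x _ => ?_
  omega

theorem image_cube_mem_shiftExtension {p : ℕ} (hp : 0 < p) {S : Finset ℕ}
    (hS : S ⊆ Finset.Ioo p (2 * p)) :
    (fun x => p * (3 * p) + x) '' (cubeBase p ∪ (S : Set ℕ)) ∈ shiftExtension (NECFLINSET p) := by
  rw [← linSpan_eq_cube hp hS subset_rfl cubeGens_subset_cube]
  refine image_linSpan_mem_shiftExtension (C := NECFLINSET p) ⟨_, isGenSet_cubeGens hp hS,
    gcd_eq_one_of_cubeGens_subset hp subset_rfl, rfl⟩ ?_
  -- At most `p` generators, each at most `3 * p`: one shift serves all `S`.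
  refine (Finset.sum_le_card_nsmul _ _ (3 * p) fun g hg => (le_of_mem_cubeGens hS hg).2.1).trans ?_
  exact Nat.mul_le_mul_right _ (card_cubeGens_le hp hS)

/-- Each `x ∉ S` enters as `x + p`, so the sum depends on `S` only through its cardinality. -/
theorem sum_cubeGens_add {p : ℕ} (hp : 0 < p) {S : Finset ℕ} (hS : S ⊆ Finset.Ioo p (2 * p)) :
    ∑ g ∈ cubeGens p S, g + p * S.card = ∑ x ∈ Finset.Ioo p (2 * p), x + p * p := by
  have h1 := Finset.card_sdiff_add_card_eq_card hS
  have h2 := Finset.sum_sdiff (f := fun g : ℕ => g) hS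
  rw [Nat.card_Ioo] at h1
  have hd : Disjoint S ((Finset.Ioo p (2 * p) \ S).image fun x => x + p) := by
    rw [Finset.disjoint_left]
    intro x hx hx'
    obtain ⟨y, hy, rfl⟩ := Finset.mem_image.1 hx'
    have h3 := Finset.mem_Ioo.1 (hS hx)
    have h4 := Finset.mem_Ioo.1 (Finset.mem_sdiff.1 hy).1
    omega
  have hp' : p ∉ S ∪ (Finset.Ioo p (2 * p) \ S).image fun x => x + p := by
    intro h
    rcases Finset.mem_union.1 h with h | h
    · exact lt_irrefl p (Finset.mem_Ioo.1 (hS h)).1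
    · obtain ⟨y, hy, hy'⟩ := Finset.mem_image.1 h
      have h4 := Finset.mem_Ioo.1 (Finset.mem_sdiff.1 hy).1
      omega
  rw [cubeGens, Finset.sum_insert hp', Finset.sum_union hd,
    Finset.sum_image (fun _ _ _ _ h => Nat.add_right_cancel h), Finset.sum_add_distrib,
    Finset.sum_const, smul_eq_mul, ← h2]
  obtain ⟨q, rfl⟩ : ∃ q, p = q + 1 := ⟨p - 1, by omega⟩
  have h5 : (Finset.Ioo (q + 1) (2 * (q + 1)) \ S).card + S.card = q := by omega
  generalize (Finset.Ioo (q + 1) (2 * (q + 1)) \ S).card = a at h5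
  subst h5
  ring

/-- With one more generator, the sums of the generators of `cubeBase p ∪ S` become equal. -/
theorem image_cube_mem_NECFLINSET {p : ℕ} (hp : 0 < p) {S : Finset ℕ}
    (hS : S ⊆ Finset.Ioo p (2 * p)) :
    (fun x => (∑ x ∈ Finset.Ioo p (2 * p), x + p * p + p * 2) + x) ''
      (cubeBase p ∪ (S : Set ℕ)) ∈ NECFLINSET (p + 1) := by
  -- In the extra generator `p * (2 + S.card)`, the part `p * S.card` levels the sums, and the part
  -- `2 * p` puts it in the tail, where it is redundant, and keeps it different from `p`.
  have hle : p * 2 ≤ p * (2 + S.card) := Nat.mul_le_mul_left _ (by omega)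
  have hnot : p * (2 + S.card) ∉ cubeGens p S := fun h => by
    have := (le_of_mem_cubeGens hS h).2.2 (dvd_mul_right _ _)
    omega
  have hsub : cubeGens p S ⊆ insert (p * (2 + S.card)) (cubeGens p S) := Finset.subset_insert _ _
  obtain ⟨h1, h2, h3⟩ := isGenSet_cubeGens hp hS
  refine ⟨insert (p * (2 + S.card)) (cubeGens p S), ⟨?_, ?_, ?_⟩,
    gcd_eq_one_of_cubeGens_subset hp hsub, ?_⟩
  · intro g hg
    rcases Finset.mem_insert.1 hg with rfl | hg
    · omega
    · exact h1 g hg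
  · exact h2.trans (Finset.card_le_card hsub)
  · exact (Finset.card_insert_le _ _).trans (by omega)
  · rw [linSpanPos_eq_image, linSpan_eq_cube hp hS hsub, Finset.sum_insert hnot,
      ← sum_cubeGens_add hp hS, show p * (2 + S.card) + ∑ g ∈ cubeGens p S, g =
        ∑ g ∈ cubeGens p S, g + p * S.card + p * 2 by ring]
    intro g hg
    rcases Finset.mem_insert.1 hg with rfl | hg
    · exact Or.inl (Or.inr (Or.inr (by omega)))
    · exact cubeGens_subset_cube g hg

/-! ### Rays and the span of k + 1, ..., 2k. -/

theorem linSpan_eq_univ {G : Finset ℕ} (h : 1 ∈ G) : linSpan G = Set.univ := by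
  refine Set.eq_univ_of_forall fun n => ?_
  rw [linSpan_eq_closure]
  have := nsmul_mem (AddSubmonoid.subset_closure (s := (G : Set ℕ)) h) n
  simpa using this

theorem image_add_univ (c : ℕ) : (fun x => c + x) '' Set.univ = Set.Ici c := by
  ext n
  simp only [Set.image_univ, Set.mem_range, Set.mem_Ici]
  exact ⟨by rintro ⟨y, rfl⟩; omega, fun h => ⟨n - c, by omega⟩⟩

/-- The generators `1` and `n - 1` sum to `n`; `3 ≤ n` keeps them distinct. -/
theorem Ici_mem_NECFLINSET {k n : ℕ} (hk : 2 ≤ k) (hn : 3 ≤ n) : Set.Ici n ∈ NECFLINSET k := by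
  have h1 : 1 ∉ ({n - 1} : Finset ℕ) := by
    rw [Finset.mem_singleton]
    omega
  refine ⟨{1, n - 1}, ⟨?_, ?_, ?_⟩, ?_, ?_⟩
  · intro g hg
    simp only [Finset.mem_insert, Finset.mem_singleton] at hg
    omega
  · rw [Finset.card_insert_of_notMem h1]
    omega
  · rw [Finset.card_insert_of_notMem h1]
    simpa using hk
  · exact Nat.dvd_one.1 (Finset.gcd_dvd (f := id) (Finset.mem_insert_self _ _))
  · rw [linSpanPos_eq_image, linSpan_eq_univ (Finset.mem_insert_self _ _), image_add_univ,
      Finset.sum_insert h1, Finset.sum_singleton]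
    congr 1
    omega

theorem Ici_mem_shiftExtension {k n : ℕ} (hk : 0 < k) (hn : 0 < n) :
    Set.Ici n ∈ shiftExtension (NECFLINSET k) := by
  rw [← image_add_univ, ← linSpan_eq_univ (Finset.mem_singleton_self 1)]
  refine image_linSpan_mem_shiftExtension (C := NECFLINSET k)
    ⟨{1}, ⟨by simp, by simp, ?_⟩, by simp, rfl⟩ ?_
  · rwa [Finset.card_singleton]
  · rwa [Finset.sum_singleton]

theorem isGenSet_Ioc {k : ℕ} (hk : 0 < k) : IsGenSet k (Finset.Ioc k (2 * k)) := by
  refine ⟨fun g hg => ?_, ?_, ?_⟩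
  · have := Finset.mem_Ioc.1 hg
    omega
  · rw [Nat.card_Ioc]
    omega
  · rw [Nat.card_Ioc]
    omega

/-- Two consecutive integers are present; for `k = 1` the only generator would be `2`. -/
theorem gcd_Ioc {k : ℕ} (hk : 2 ≤ k) : (Finset.Ioc k (2 * k)).gcd id = 1 := by
  have h1 : (Finset.Ioc k (2 * k)).gcd id ∣ k + 1 :=
    Finset.gcd_dvd (f := id) (Finset.mem_Ioc.2 ⟨by omega, by omega⟩)
  have h2 : (Finset.Ioc k (2 * k)).gcd id ∣ k + 1 + 1 :=
    Finset.gcd_dvd (f := id) (Finset.mem_Ioc.2 ⟨by omega, by omega⟩)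
  exact Nat.dvd_one.1 ((Nat.dvd_add_right h1).1 h2)

theorem image_linSpan_Ioc_mem_shiftExtension {C : Set (Set ℕ)} {k : ℕ}
    (hC : linSpanPos (Finset.Ioc k (2 * k)) ∈ C) :
    (fun x => k * (3 * k) + x) '' linSpan (Finset.Ioc k (2 * k)) ∈ shiftExtension C := by
  refine image_linSpan_mem_shiftExtension hC ?_
  refine (Finset.sum_le_card_nsmul _ _ (3 * k) fun g hg => ?_).trans ?_
  · have := Finset.mem_Ioc.1 hg
    omega
  · rw [Nat.card_Ioc, smul_eq_mul]
    exact Nat.mul_le_mul_right _ (by omega)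

/-! ### Lower bounds from the cube. -/

theorem le_PBTD_of_cube {C : Set (Set ℕ)} (p c : ℕ) (h : ∀ S ⊆ Finset.Ioo p (2 * p),
    (fun x => c + x) '' (cubeBase p ∪ (S : Set ℕ)) ∈ C) : ((p - 1 : ℕ) : ℕ∞) ≤ PBTD C := by
  have hinj : Function.Injective fun x => c + x := add_right_injective c
  have hcard : ((Finset.Ioo p (2 * p)).image fun x => c + x).card = p - 1 := by
    rw [Finset.card_image_of_injective _ hinj, Nat.card_Ioo]
    omega
  rw [← hcard]
  refine card_le_PBTD_of_cube ((fun x => c + x) '' cubeBase p) _ ?_ ?_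
  · intro x hx
    obtain ⟨y, hy, rfl⟩ := Finset.mem_image.1 hx
    rw [hinj.mem_set_image]
    have := Finset.mem_Ioo.1 hy
    rintro (h | h | h) <;> omega
  · intro U hU
    obtain ⟨V, hV, rfl⟩ := Finset.subset_image_iff.1 hU
    rw [Finset.coe_image, ← Set.image_union]
    exact h V (by simpa using hV)

theorem mem_image_cube_Ioo {p c n : ℕ} :
    n ∈ (fun x => c + x) '' (cubeBase p ∪ (Finset.Ioo p (2 * p) : Set ℕ)) ↔ n = c ∨ c + p ≤ n := by
  constructor
  · rintro ⟨y, hy, rfl⟩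
    rw [mem_cubeBase_union, Finset.mem_Ioo] at hy
    dsimp only
    omega
  · intro h
    refine ⟨n - c, ?_, by dsimp only; omega⟩
    rw [mem_cubeBase_union, Finset.mem_Ioo]
    omega

theorem image_cube_diff_singleton (p c : ℕ) {x : ℕ} (hx : x ∈ Finset.Ioo p (2 * p)) :
    (fun x => c + x) '' (cubeBase p ∪ (Finset.Ioo p (2 * p) : Set ℕ)) \ {c + x} =
      (fun x => c + x) '' (cubeBase p ∪ ((Finset.Ioo p (2 * p)).erase x : Set ℕ)) := by
  rw [← Set.image_singleton (f := fun x => c + x), ← Set.image_sdiff (add_right_injective c)]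
  congr 1
  ext n
  rw [Set.mem_sdiff, mem_cubeBase_union, mem_cubeBase_union, Finset.mem_erase,
    Set.mem_singleton_iff]
  have := Finset.mem_Ioo.1 hx
  constructor
  · rintro ⟨h | h, hne⟩
    · exact Or.inl h
    · exact Or.inr ⟨hne, h⟩
  · rintro (h | ⟨hne, h⟩)
    · exact ⟨Or.inl h, by omega⟩
    · exact ⟨Or.inr h, hne⟩

theorem image_cube_diff_zero (p c : ℕ) (hp : 0 < p) :
    (fun x => c + x) '' (cubeBase p ∪ (Finset.Ioo p (2 * p) : Set ℕ)) \ {c} = Set.Ici (c + p) := by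
  ext n
  rw [Set.mem_sdiff, mem_image_cube_Ioo, Set.mem_singleton_iff, Set.mem_Ici]
  omega

theorem linSpan_Ioc_ssubset {k c : ℕ} (hk : 0 < k) :
    (fun x => c + x) '' linSpan (Finset.Ioc k (2 * k)) ⊂
      (fun x => c + x) '' (cubeBase k ∪ (Finset.Ioo k (2 * k) : Set ℕ)) := by
  have hlt : ∀ n ∈ linSpan (Finset.Ioc k (2 * k)), n = 0 ∨ k < n := by
    intro n hn
    rw [linSpan_eq_closure] at hn
    induction hn using AddSubmonoid.closure_induction with
    | mem x hx => exact Or.inr (Finset.mem_Ioc.1 hx).1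
    | zero => exact Or.inl rfl
    | add x y _ _ hx hy => omega
  refine ⟨?_, fun h => ?_⟩
  · rintro _ ⟨n, hn, rfl⟩
    rw [mem_image_cube_Ioo]
    have := hlt n hn
    dsimp only
    omega
  · obtain ⟨n, hn, hnk⟩ := h (mem_image_cube_Ioo.2 (Or.inr le_rfl))
    have := hlt n hn
    dsimp only at hnk
    omega

theorem mem_linSpan_Ioc {k x : ℕ} (hx : x = 0 ∨ x ∈ Finset.Ioo k (2 * k)) :
    x ∈ linSpan (Finset.Ioc k (2 * k)) := by
  rw [linSpan_eq_closure]
  rcases hx with rfl | hx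
  · exact zero_mem _
  · exact AddSubmonoid.subset_closure (Finset.Ioo_subset_Ioc_self hx)

/-- The points to be shown are `c` and `c + y` with `k < y < 2k`; removing `c` from the top of the
cube leaves a ray. -/
theorem le_posPBTD_of_Ici_mem {C : Set (Set ℕ)} {k : ℕ} (c : ℕ) (hk : 0 < k)
    (hC : ∀ S ⊆ Finset.Ioo k (2 * k), (fun x => c + x) '' (cubeBase k ∪ (S : Set ℕ)) ∈ C)
    (h : Set.Ici (c + k) ∈ C) : (k : ℕ∞) ≤ posPBTD C := by
  have h0 : 0 ∉ Finset.Ioo k (2 * k) := by simp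
  have hcard : ((insert 0 (Finset.Ioo k (2 * k))).image fun x => c + x).card = k := by
    rw [Finset.card_image_of_injective _ (add_right_injective c), Finset.card_insert_of_notMem h0,
      Nat.card_Ioo]
    omega
  conv_lhs => rw [← hcard]
  refine card_le_posPBTD (hC _ subset_rfl) _ ?_ c (Finset.mem_image.2 ⟨0, by simp, rfl⟩) ?_
    ⟨_, h, ?_, ?_⟩
  · intro x hx
    obtain ⟨y, hy, rfl⟩ := Finset.mem_image.1 hx
    rw [Finset.mem_insert, Finset.mem_Ioo] at hy
    rw [mem_image_cube_Ioo]
    omega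
  · intro x hx hne
    obtain ⟨y, hy, rfl⟩ := Finset.mem_image.1 hx
    rcases Finset.mem_insert.1 hy with rfl | hy
    · exact absurd rfl hne
    · rw [image_cube_diff_singleton k c hy]
      exact hC _ (Finset.erase_subset _ _)
  · intro x hx hne
    obtain ⟨y, hy, rfl⟩ := Finset.mem_image.1 hx
    rw [Finset.mem_insert, Finset.mem_Ioo] at hy
    rw [Set.mem_Ici]
    omega
  · rw [← image_cube_diff_zero k c hk]
    exact Set.sdiff_singleton_ssubset.2 (mem_image_cube_Ioo.2 (Or.inl rfl))

/-- Removing `k` from {0} ∪ [k, ∞) leaves a semigroup needing `k + 1` generators. The span of k + 1,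
..., 2k replaces it: it avoids `k` but keeps the other test points. -/
theorem le_posPBTD_of_linSpan_Ioc_mem {C : Set (Set ℕ)} {k : ℕ} (c : ℕ) (hk : 0 < k)
    (hC : ∀ S ⊆ Finset.Ioo k (2 * k), (fun x => c + x) '' (cubeBase k ∪ (S : Set ℕ)) ∈ C)
    (h : (fun x => c + x) '' linSpan (Finset.Ioc k (2 * k)) ∈ C) : (k : ℕ∞) ≤ posPBTD C := by
  have h0 : k ∉ Finset.Ioo k (2 * k) := by simp
  have hcard : ((insert k (Finset.Ioo k (2 * k))).image fun x => c + x).card = k := by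
    rw [Finset.card_image_of_injective _ (add_right_injective c), Finset.card_insert_of_notMem h0,
      Nat.card_Ioo]
    omega
  conv_lhs => rw [← hcard]
  refine card_le_posPBTD (hC _ subset_rfl) _ ?_ (c + k) (Finset.mem_image.2 ⟨k, by simp, rfl⟩) ?_
    ⟨_, h, ?_, linSpan_Ioc_ssubset hk⟩
  · intro x hx
    obtain ⟨y, hy, rfl⟩ := Finset.mem_image.1 hx
    rw [Finset.mem_insert, Finset.mem_Ioo] at hy
    rw [mem_image_cube_Ioo]
    omega
  · intro x hx hne
    obtain ⟨y, hy, rfl⟩ := Finset.mem_image.1 hx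
    rcases Finset.mem_insert.1 hy with rfl | hy
    · exact absurd rfl hne
    · rw [image_cube_diff_singleton k c hy]
      exact hC _ (Finset.erase_subset _ _)
  · intro x hx hne
    obtain ⟨y, hy, rfl⟩ := Finset.mem_image.1 hx
    rcases Finset.mem_insert.1 hy with rfl | hy
    · exact absurd rfl hne
    · exact ⟨y, mem_linSpan_Ioc (Or.inr hy), rfl⟩

/-- Both devices combine: the ray handles omission of `c`, the span of k + 1, ..., 2k handles
omission of `c + k`, and the cube handles the other `k - 1` points. -/
theorem add_one_le_posPBTD {C : Set (Set ℕ)} {k : ℕ} (c : ℕ) (hk : 0 < k)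
    (hC : ∀ S ⊆ Finset.Ioo k (2 * k), (fun x => c + x) '' (cubeBase k ∪ (S : Set ℕ)) ∈ C)
    (h : (fun x => c + x) '' linSpan (Finset.Ioc k (2 * k)) ∈ C)
    (h' : Set.Ici (c + k) ∈ C) : ((k + 1 : ℕ) : ℕ∞) ≤ posPBTD C := by
  have h0 : k ∉ Finset.Ioo k (2 * k) := by simp
  have h1 : 0 ∉ insert k (Finset.Ioo k (2 * k)) := by simp [hk.ne]
  have hcard : ((insert 0 (insert k (Finset.Ioo k (2 * k)))).image fun x => c + x).card =
      k + 1 := by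
    rw [Finset.card_image_of_injective _ (add_right_injective c), Finset.card_insert_of_notMem h1,
      Finset.card_insert_of_notMem h0, Nat.card_Ioo]
    omega
  rw [← hcard]
  refine card_le_posPBTD (hC _ subset_rfl) _ ?_ (c + k) (Finset.mem_image.2 ⟨k, by simp, rfl⟩) ?_
    ⟨_, h, ?_, linSpan_Ioc_ssubset hk⟩
  · intro x hx
    obtain ⟨y, hy, rfl⟩ := Finset.mem_image.1 hx
    rw [Finset.mem_insert, Finset.mem_insert, Finset.mem_Ioo] at hy
    rw [mem_image_cube_Ioo]
    omega
  · intro x hx hne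
    obtain ⟨y, hy, rfl⟩ := Finset.mem_image.1 hx
    rcases Finset.mem_insert.1 hy with rfl | hy
    · rw [add_zero, image_cube_diff_zero k c hk]
      exact h'
    rcases Finset.mem_insert.1 hy with rfl | hy
    · exact absurd rfl hne
    · rw [image_cube_diff_singleton k c hy]
      exact hC _ (Finset.erase_subset _ _)
  · intro x hx hne
    obtain ⟨y, hy, rfl⟩ := Finset.mem_image.1 hx
    rcases Finset.mem_insert.1 hy with rfl | hy
    · exact ⟨0, mem_linSpan_Ioc (Or.inl rfl), rfl⟩
    rcases Finset.mem_insert.1 hy with rfl | hy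
    · exact absurd rfl hne
    · exact ⟨y, mem_linSpan_Ioc (Or.inr hy), rfl⟩

/-! ### Application to the four classes and their shift-extensions. -/

theorem image_cube_mem_CFLINSET {k : ℕ} (hk : 0 < k) {S : Finset ℕ}
    (hS : S ⊆ Finset.Ioo k (2 * k)) :
    (fun x => 0 + x) '' (cubeBase k ∪ (S : Set ℕ)) ∈ CFLINSET k := by
  simpa using cube_mem_CFLINSET hk hS

theorem image_linSpan_Ioc_mem_LINSET {k : ℕ} (hk : 0 < k) :
    (fun x => 0 + x) '' linSpan (Finset.Ioc k (2 * k)) ∈ LINSET k := by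
  simpa using ⟨_, isGenSet_Ioc hk, rfl⟩

theorem image_linSpan_Ioc_mem_CFLINSET {k : ℕ} (hk : 2 ≤ k) :
    (fun x => 0 + x) '' linSpan (Finset.Ioc k (2 * k)) ∈ CFLINSET k := by
  simpa using ⟨_, isGenSet_Ioc (by omega), gcd_Ioc hk, rfl⟩

theorem sub_one_le_posPBTD_NECFLINSET {k : ℕ} (hk : 1 ≤ k) :
    ((k - 1 : ℕ) : ℕ∞) ≤ posPBTD (NECFLINSET k) := by
  -- The levelling generator uses one of the `k`, so the cube has parameter `k - 1`.
  obtain ⟨p, rfl⟩ : ∃ p, k = p + 1 := ⟨k - 1, by omega⟩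
  rw [Nat.add_sub_cancel]
  rcases Nat.eq_zero_or_pos p with rfl | hp
  · simp
  · exact le_posPBTD_of_Ici_mem _ hp (fun S hS => image_cube_mem_NECFLINSET hp hS)
      (Ici_mem_NECFLINSET (by omega) (by omega))

theorem sub_two_le_PBTD_NECFLINSET {k : ℕ} (hk : 2 ≤ k) :
    ((k - 2 : ℕ) : ℕ∞) ≤ PBTD (NECFLINSET k) := by
  obtain ⟨p, rfl⟩ : ∃ p, k = p + 1 := ⟨k - 1, by omega⟩
  exact le_PBTD_of_cube p _ fun S hS => image_cube_mem_NECFLINSET (by omega) hS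

theorem half_le_PBTD_NECFLINSET {k : ℕ} (hk : 1 ≤ k) :
    (((k - 1) / 2 : ℕ) : ℕ∞) ≤ PBTD (NECFLINSET k) := by
  rcases hk.eq_or_lt with rfl | hk
  · simp
  -- For `k ≥ 2` the cube gives the stronger bound `k - 2`, which is at least `(k - 1) / 2`.
  · exact (Nat.cast_le.2 (by omega)).trans (sub_two_le_PBTD_NECFLINSET hk)

theorem sub_one_le_PBTD_shiftExtension {k : ℕ} (hk : 1 ≤ k) :
    ((k - 1 : ℕ) : ℕ∞) ≤ PBTD (shiftExtension (NECFLINSET k)) :=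
  le_PBTD_of_cube k _ fun _ hS => image_cube_mem_shiftExtension hk hS

theorem add_one_le_posPBTD_shiftExtension {C : Set (Set ℕ)} {k : ℕ} (hk : 1 ≤ k)
    (hC : NECFLINSET k ⊆ C) (h : linSpanPos (Finset.Ioc k (2 * k)) ∈ C) :
    ((k + 1 : ℕ) : ℕ∞) ≤ posPBTD (shiftExtension C) :=
  add_one_le_posPBTD _ hk
    (fun _ hS => shiftExtension_mono hC (image_cube_mem_shiftExtension hk hS))
    (image_linSpan_Ioc_mem_shiftExtension h)
    (shiftExtension_mono hC (Ici_mem_shiftExtension hk (by omega)))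

/-- Sets with positive coefficients are shifts of linear sets and shifting twice is shifting once,
so all four extensions lie between two extremes. -/
theorem shiftExtension_bounds {C : Set (Set ℕ)} {k : ℕ}
    (hC : C ∈ ({LINSET k, CFLINSET k, NELINSET k, NECFLINSET k} : Set (Set (Set ℕ)))) :
    shiftExtension (NECFLINSET k) ⊆ shiftExtension C ∧
      shiftExtension C ⊆ shiftExtension (LINSET k) := by
  have h1 := shiftExtension_NECFLINSET_subset k
  have h2 := shiftExtension_mono (CFLINSET_subset_LINSET k)
  have h3 := shiftExtension_mono (NECFLINSET_subset_NELINSET k)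
  have h4 := shiftExtension_NELINSET_subset k
  rcases hC with rfl | rfl | rfl | rfl
  · exact ⟨h1.trans h2, subset_rfl⟩
  · exact ⟨h1, h2⟩
  · exact ⟨h3, h4⟩
  · exact ⟨subset_rfl, h1.trans h2⟩

theorem eq_or_eq_of_sub_one_le {k : ℕ} {x : ℕ∞} (h : ((k - 1 : ℕ) : ℕ∞) ≤ x) (h' : x ≤ k) :
    x = ((k - 1 : ℕ) : ℕ∞) ∨ x = k := by
  lift x to ℕ using ne_top_of_le_ne_top (ENat.natCast_ne_top k) h'
  norm_cast at h h' ⊢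
  omega

end Teaching

theorem mainTheorem1 (k : ℕ) (hk : 1 ≤ k) :
    -- the table; the bound `k` for `CFLINSET` needs `k ≥ 2`, as `CFLINSET 1` is a one-element class
    (Teaching.posPBTD (Teaching.LINSET k) = (k : ℕ∞) ∧
      Teaching.PBTD (Teaching.LINSET k) ∈ ({((k - 1 : ℕ) : ℕ∞), (k : ℕ∞)} : Set ℕ∞)) ∧
    ((2 ≤ k → Teaching.posPBTD (Teaching.CFLINSET k) = (k : ℕ∞)) ∧
      Teaching.PBTD (Teaching.CFLINSET k) ∈ ({((k - 1 : ℕ) : ℕ∞), (k : ℕ∞)} : Set ℕ∞)) ∧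
    (Teaching.posPBTD (Teaching.NELINSET k) ∈ Set.Icc ((k - 1 : ℕ) : ℕ∞) (k : ℕ∞) ∧
      Teaching.PBTD (Teaching.NELINSET k) ∈ Set.Icc (((k - 1) / 2 : ℕ) : ℕ∞) (k : ℕ∞)) ∧
    (Teaching.posPBTD (Teaching.NECFLINSET k) ∈ Set.Icc ((k - 1 : ℕ) : ℕ∞) (k : ℕ∞) ∧
      Teaching.PBTD (Teaching.NECFLINSET k) ∈ Set.Icc (((k - 1) / 2 : ℕ) : ℕ∞) (k : ℕ∞)) ∧
    -- the shift-extensions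
    (∀ C ∈ ({Teaching.LINSET k, Teaching.NELINSET k} : Set (Set (Set ℕ))),
      Teaching.posPBTD (Teaching.shiftExtension C) = ((k + 1 : ℕ) : ℕ∞)) ∧
    (2 ≤ k → ∀ C ∈ ({Teaching.CFLINSET k, Teaching.NECFLINSET k} : Set (Set (Set ℕ))),
      Teaching.posPBTD (Teaching.shiftExtension C) = ((k + 1 : ℕ) : ℕ∞)) ∧
    (∀ C ∈ ({Teaching.LINSET k, Teaching.CFLINSET k, Teaching.NELINSET k, Teaching.NECFLINSET k} :
        Set (Set (Set ℕ))),
      Teaching.PBTD (Teaching.shiftExtension C) ∈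
        ({((k - 1 : ℕ) : ℕ∞), (k : ℕ∞), ((k + 1 : ℕ) : ℕ∞)} : Set ℕ∞)) := by
  have hLINle := Teaching.posPBTD_LINSET_le k
  have hCFle := (Teaching.posPBTD_mono (Teaching.CFLINSET_subset_LINSET k)).trans hLINle
  have hNEle := Teaching.posPBTD_NELINSET_le k
  have hNECFle := (Teaching.posPBTD_mono (Teaching.NECFLINSET_subset_NELINSET k)).trans hNEle
  have hcube : ((k - 1 : ℕ) : ℕ∞) ≤ Teaching.PBTD (Teaching.CFLINSET k) :=
    Teaching.le_PBTD_of_cube k 0 fun _ hS => Teaching.image_cube_mem_CFLINSET hk hS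
  have hshift := Teaching.posPBTD_shiftExtension_LINSET_le k
  refine ⟨⟨hLINle.antisymm ?_, ?_⟩, ⟨fun hk2 => hCFle.antisymm ?_, ?_⟩, ⟨⟨?_, hNEle⟩, ?_, ?_⟩,
    ⟨⟨?_, hNECFle⟩, ?_, ?_⟩, fun C hC => ?_, fun hk2 C hC => ?_, fun C hC => ?_⟩
  · exact Teaching.le_posPBTD_of_linSpan_Ioc_mem 0 hk
      (fun _ hS => Teaching.CFLINSET_subset_LINSET k (Teaching.image_cube_mem_CFLINSET hk hS))
      (Teaching.image_linSpan_Ioc_mem_LINSET hk)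
  · exact Teaching.eq_or_eq_of_sub_one_le
      (hcube.trans (Teaching.PBTD_mono (Teaching.CFLINSET_subset_LINSET k)))
      ((Teaching.PBTD_le_posPBTD _).trans hLINle)
  · exact Teaching.le_posPBTD_of_linSpan_Ioc_mem 0 hk
      (fun _ hS => Teaching.image_cube_mem_CFLINSET hk hS)
      (Teaching.image_linSpan_Ioc_mem_CFLINSET hk2)
  · exact Teaching.eq_or_eq_of_sub_one_le hcube ((Teaching.PBTD_le_posPBTD _).trans hCFle)
  · exact (Teaching.sub_one_le_posPBTD_NECFLINSET hk).trans
      (Teaching.posPBTD_mono (Teaching.NECFLINSET_subset_NELINSET k))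
  · exact (Teaching.half_le_PBTD_NECFLINSET hk).trans
      (Teaching.PBTD_mono (Teaching.NECFLINSET_subset_NELINSET k))
  · exact (Teaching.PBTD_le_posPBTD _).trans hNEle
  · exact Teaching.sub_one_le_posPBTD_NECFLINSET hk
  · exact Teaching.half_le_PBTD_NECFLINSET hk
  · exact (Teaching.PBTD_le_posPBTD _).trans hNECFle
  -- Without a gcd condition the span of k + 1, ..., 2k is available also for `k = 1`.
  · have hNE := Teaching.add_one_le_posPBTD_shiftExtension hk
      (Teaching.NECFLINSET_subset_NELINSET k) ⟨_, Teaching.isGenSet_Ioc hk, rfl⟩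
    have hsub := Teaching.shiftExtension_NELINSET_subset k
    rcases hC with rfl | rfl
    · exact hshift.antisymm (hNE.trans (Teaching.posPBTD_mono hsub))
    · exact ((Teaching.posPBTD_mono hsub).trans hshift).antisymm hNE
  · obtain ⟨h1, h2⟩ := Teaching.shiftExtension_bounds (k := k) (Or.inr (hC.imp_right Or.inr))
    have hNECF := Teaching.add_one_le_posPBTD_shiftExtension (C := Teaching.NECFLINSET k) hk
      subset_rfl ⟨_, Teaching.isGenSet_Ioc hk, Teaching.gcd_Ioc hk2, rfl⟩
    exact ((Teaching.posPBTD_mono h2).trans hshift).antisymm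
      (hNECF.trans (Teaching.posPBTD_mono h1))
  · obtain ⟨h1, h2⟩ := Teaching.shiftExtension_bounds hC
    have hlow := (Teaching.sub_one_le_PBTD_shiftExtension hk).trans (Teaching.PBTD_mono h1)
    have hup := (Teaching.PBTD_le_posPBTD _).trans ((Teaching.posPBTD_mono h2).trans hshift)
    rcases eq_or_ne (Teaching.PBTD (Teaching.shiftExtension C)) ((k + 1 : ℕ) : ℕ∞) with h | h
    · exact Or.inr (Or.inr h)
    · refine (Teaching.eq_or_eq_of_sub_one_le hlow ?_).imp_right Or.inl
      rw [← ENat.lt_add_one_iff (ENat.natCast_ne_top k)]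
      exact lt_of_le_of_ne hup h
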